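/- Let $\mathbb H^2$ be the hyperbolic plane, $O\in\mathbb H^2$, and $(r,\theta)$ geodesic polar coordinates centred at $O$, so that the metric is $dr^2+\sinh^2 r\,d\theta^2$. Let $\Omega\subset\mathbb H^2$ be a nonempty connected open set invariant under the rotations about $O$. For $\varepsilon\in\{+1,-1\}$ and $q>0$, $q\neq 1$, consider $$\Delta_{\mathbb H^2}u=\varepsilon\,u|u|^{q-1}\qquad(1)$$ in $\Omega$. A solution is a $C^2$ function on $\Omega\setminus\{O\}$ satisfying the equation there (it may be singular at $O$ if $O\in\Omega$). It is pseudo-radial if $u(r,\theta)=h(r)w(\theta)$ on $\Omega\setminus\{O\}$ for some functions $h$ and $w$, with $w$ $2\pi$-periodic, and radial if it depends only on $r$. (i) If $\varepsilon=+1$ or $q\neq 3$, then every pseudo-radial solution of (1) is radial. (ii) The equation $\Delta_{\mathbb H^2}u=-u^3$ has infinitely many non-radial pseudo-radial solutions in $\Omega$. More precisely, for every integer $k\ge 2$ the ordinary differential equation $$w''+w=-w^3\quad\text{on }\mathbb R$$ has a solution $w_k$ with $w_k(0)=0$ and least period $2\pi/k$; it is the unique one up to sign, and every solution with least period $2\pi/k$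 is a translate $w_k(\cdot+\theta_0)$ of it. For every integer $k\ge2$ the function $w_k(\theta)/\sinh r$ is a non-radial pseudo-radial solution, and the non-radial pseudo-radial solutions of $\Delta_{\mathbb H^2}u=-u^3$ in $\Omega$ are exactly the functions $$u(r,\theta)=\frac{w_k(\theta+\theta_0)}{\sinh r},\qquad k\ge 2,\ \theta_0\in\mathbb R .$$ -/

import Mathlib

noncomputable section

namespace HypPlane

/-- The hyperbolic plane is the unit disc of `ℂ` with the metric `λ(z)² |dz|²`, of curvature `-1`,
where `λ(z) = 2 / (1 - |z|²)`. -/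
def conformalFactor (z : ℂ) : ℝ := 2 / (1 - ‖z‖ ^ 2)

/-- The Laplace-Beltrami operator of the conformal metric `λ(z)² |dz|²`: in dimension two it is
`λ⁻²` times the Euclidean Laplacian. -/
def hypLaplacian (u : ℂ → ℝ) (z : ℂ) : ℝ := (conformalFactor z ^ 2)⁻¹ * Laplacian.laplacian u z

/-- Geodesic polar coordinates centred at `0`: the point at hyperbolic distance `r` from `0`
(that is, at Euclidean distance `tanh (r / 2)`) in the direction `θ`. In these coordinates the
metric is `dr² + sinh² r dθ²`. -/
def polar (r θ : ℝ) : ℂ := (Real.tanh (r / 2) : ℂ) * Complex.exp (θ * Complex.I)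

/-- A rotationally symmetric domain of the hyperbolic plane, with centre `0`: a nonempty connected
open subset of the disc that is invariant under all rotations about `0`. -/
structure IsRotSymmDomain (Ω : Set ℂ) : Prop where
  subset_disc : Ω ⊆ Metric.ball 0 1
  isOpen : IsOpen Ω
  isConnected : IsConnected Ω
  rot_mem : ∀ z ∈ Ω, ∀ θ : ℝ, Complex.exp (θ * Complex.I) * z ∈ Ω

/-- `u` is a classical, possibly singular at the centre, solution of `Δ u = F(u)` in `Ω`.
Only the values of `u` in `Ω` outside the centre matter. -/
def IsSolution (Ω : Set ℂ) (F : ℝ → ℝ) (u : ℂ → ℝ) : Prop :=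
  ContDiffOn ℝ 2 u (Ω \ {0}) ∧ ∀ z ∈ Ω \ {0}, hypLaplacian u z = F (u z)

/-- `u = h(r) w(θ)` in `Ω`, with `w` a `2π`-periodic function. -/
def IsPseudoRadial (Ω : Set ℂ) (u : ℂ → ℝ) : Prop :=
  ∃ h w : ℝ → ℝ, Function.Periodic w (2 * Real.pi) ∧
    ∀ r θ : ℝ, 0 < r → polar r θ ∈ Ω → u (polar r θ) = h r * w θ

/-- `u` depends only on `r` in `Ω`. -/
def IsRadial (Ω : Set ℂ) (u : ℂ → ℝ) : Prop :=
  ∃ f : ℝ → ℝ, ∀ r θ : ℝ, 0 < r → polar r θ ∈ Ω → u (polar r θ) = f r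

/-- The non-radial pseudo-radial solutions of `Δ u = F(u)` in `Ω`. -/
def nonRadialPseudoRadialSolutions (Ω : Set ℂ) (F : ℝ → ℝ) : Set (ℂ → ℝ) :=
  {u | IsSolution Ω F u ∧ IsPseudoRadial Ω u ∧ ¬ IsRadial Ω u}

/-- `T` is the least positive period of `w`. -/
def IsLeastPeriod (w : ℝ → ℝ) (T : ℝ) : Prop :=
  IsLeast {S : ℝ | 0 < S ∧ Function.Periodic w S} T

/-- `w` is a solution on the whole line of `w'' + w = -w³` with least period `2π/k`. -/
def IsModeSolution (k : ℕ) (w : ℝ → ℝ) : Prop :=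
  ContDiff ℝ 2 w ∧ (∀ θ : ℝ, deriv (deriv w) θ + w θ = -(w θ) ^ 3) ∧
    IsLeastPeriod w (2 * Real.pi / k)

end HypPlane

end

noncomputable section

namespace HypPlane

open Set Real Filter Topology

/-! ### Uniqueness for autonomous second order equations -/

/-! In the conformal coordinate `ρ = log tanh (r / 2)` the Laplacian is `sinh² ρ (∂ρ² + ∂θ²)` and `1
/ sinh r = -sinh ρ`. For `u = H(ρ) w(θ)` equation (1) becomes `H'' w + H w'' = ε sinh⁻² ρ ·
Hw|Hw|^(q-1)`. If `w` is not constant, `|w|` takes two distinct nonzero values; comparing two radii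
at these angles shows that, where `H ≠ 0`, `H'' = A H` and `|H|^(q-1) = K sinh² ρ` with `A`, `K`
constant. The two relations are compatible only if `q = 3` and `A = 1` (`exponent_eq_two`). Then `H`
is a multiple of `1 / sinh r`, and after rescaling the angular factor is a `2π`-periodic solution of
`v'' + v = ε v³` (`separated_solution`).

For `ε = 1` such a solution is constant: Sturm comparison with the sine excludes zeros unless `v =
0`, and for `v > 0` the equation at a maximum and at a minimum forces `v = 1`; the sign change `v ↦
-v` covers the rest.

For `ε = -1` the energy `v'² + v² + v⁴/2 = a² + a⁴/2` allows `v = a sin φ` with `φ' = √(1 + a²(1 +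
sin² φ)/2)`. The half-period `∫₀^π dφ/φ'` is continuous and strictly decreasing in `a ≥ 0`, equals
`π` at `a = 0` and reaches every `π/k` with `k ≥ 2`. So each `k ≥ 2` has exactly one amplitude, `k =
1` has none, and ODE uniqueness makes every nonzero solution a translate of such a wave. -/

/-- The phase-plane field is only locally Lipschitz, but on a compact time interval both
trajectories stay in one ball, where it is Lipschitz. -/
theorem second_order_unique {f : ℝ → ℝ} (hf : ContDiff ℝ 1 f) {x y : ℝ → ℝ} {x' y' : ℝ → ℝ}
    (hx : ∀ t, HasDerivAt x (x' t) t) (hx' : ∀ t, HasDerivAt x' (f (x t)) t)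
    (hy : ∀ t, HasDerivAt y (y' t) t) (hy' : ∀ t, HasDerivAt y' (f (y t)) t)
    {t₀ : ℝ} (h0 : x t₀ = y t₀) (h1 : x' t₀ = y' t₀) : x = y := by
  let V : ℝ × ℝ → ℝ × ℝ := fun p => (p.2, f p.1)
  have hV : ContDiff ℝ 1 V := contDiff_snd.prodMk (hf.comp contDiff_fst)
  let X : ℝ → ℝ × ℝ := fun t => (x t, x' t)
  let Y : ℝ → ℝ × ℝ := fun t => (y t, y' t)
  have hX : ∀ t, HasDerivAt X (V (X t)) t := fun t => (hx t).prodMk (hx' t)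
  have hY : ∀ t, HasDerivAt Y (V (Y t)) t := fun t => (hy t).prodMk (hy' t)
  have hXc : Continuous X := continuous_iff_continuousAt.2 fun t => (hX t).continuousAt
  have hYc : Continuous Y := continuous_iff_continuousAt.2 fun t => (hY t).continuousAt
  funext t
  let a := min t t₀ - 1
  let b := max t t₀ + 1
  have hK : IsCompact (X '' Icc a b ∪ Y '' Icc a b) :=
    (isCompact_Icc.image hXc).union (isCompact_Icc.image hYc)
  obtain ⟨R, hR⟩ := hK.isBounded.subset_closedBall 0
  obtain ⟨K, hL⟩ := (hV.contDiffOn (s := Metric.closedBall 0 R)).exists_lipschitzOnWith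
    one_ne_zero (convex_closedBall _ _) (isCompact_closedBall _ _)
  have ht₀ : t₀ ∈ Ioo a b := ⟨by grind, by grind⟩
  have ht : t ∈ Icc a b := ⟨by grind, by grind⟩
  have key := ODE_solution_unique_of_mem_Icc (v := fun _ => V) (s := fun _ => Metric.closedBall 0 R)
    (fun _ _ => hL) ht₀ hXc.continuousOn (fun t _ => hX t)
    (fun t ht => hR (Or.inl ⟨t, Ioo_subset_Icc_self ht, rfl⟩)) hYc.continuousOn
    (fun t _ => hY t) (fun t ht => hR (Or.inr ⟨t, Ioo_subset_Icc_self ht, rfl⟩))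
    (by simp [X, Y, h0, h1])
  exact congrArg Prod.fst (key ht)

/-- `v` is a `C²` solution on the whole line of `v'' + v = c v³`. -/
def IsDuffing (c : ℝ) (v : ℝ → ℝ) : Prop :=
  ContDiff ℝ 2 v ∧ ∀ t, deriv (deriv v) t + v t = c * v t ^ 3

/-! ### Uniqueness and symmetries of `v'' + v = c v³`; periodic solutions for `c = 1`. -/

namespace IsDuffing

variable {c : ℝ} {v w : ℝ → ℝ}

theorem hasDerivAt (h : IsDuffing c v) (t : ℝ) : HasDerivAt v (deriv v t) t :=
  (h.1.differentiable two_ne_zero t).hasDerivAt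

theorem hasDerivAt_deriv (h : IsDuffing c v) (t : ℝ) :
    HasDerivAt (deriv v) (-v t + c * v t ^ 3) t := by
  have h1 : ContDiff ℝ 1 (deriv v) := ((contDiff_succ_iff_deriv (n := 1)).1
    (by simpa [one_add_one_eq_two] using h.1)).2.2
  have h2 := (h1.differentiable one_ne_zero t).hasDerivAt
  exact h2.congr_deriv (by linarith [h.2 t])

theorem of_hasDerivAt {v' : ℝ → ℝ} (h : ∀ t, HasDerivAt v (v' t) t)
    (h' : ∀ t, HasDerivAt v' (-v t + c * v t ^ 3) t) : IsDuffing c v := by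
  have e : deriv v = v' := funext fun t => (h t).deriv
  refine ⟨?_, fun t => ?_⟩
  · have hv : Continuous v := continuous_iff_continuousAt.2 fun t => (h t).continuousAt
    have : ContDiff ℝ ((1 : ℕ) + 1) v := by
      rw [contDiff_succ_iff_deriv]
      refine ⟨fun t => (h t).differentiableAt, by simp, ?_⟩
      rw [e]
      rw [Nat.cast_one, contDiff_one_iff_deriv]
      refine ⟨fun t => (h' t).differentiableAt, ?_⟩
      rw [show deriv v' = fun t => -v t + c * v t ^ 3 from funext fun t => (h' t).deriv]
      fun_prop
    simpa [one_add_one_eq_two] using this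
  · rw [e, (h' t).deriv]; ring

theorem unique (hv : IsDuffing c v) (hw : IsDuffing c w) {t₀ : ℝ} (h0 : v t₀ = w t₀)
    (h1 : deriv v t₀ = deriv w t₀) : v = w :=
  second_order_unique (f := fun s => -s + c * s ^ 3) (by fun_prop) hv.hasDerivAt
    hv.hasDerivAt_deriv hw.hasDerivAt hw.hasDerivAt_deriv h0 h1

theorem comp_add_const (hv : IsDuffing c v) (s : ℝ) : IsDuffing c fun t => v (t + s) :=
  of_hasDerivAt (fun t => (hv.hasDerivAt (t + s)).comp_add_const t s)
    (fun t => (hv.hasDerivAt_deriv (t + s)).comp_add_const t s)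

theorem neg (hv : IsDuffing c v) : IsDuffing c fun t => -v t :=
  of_hasDerivAt (v' := fun t => -deriv v t) (fun t => (hv.hasDerivAt t).neg)
    (fun t => (hv.hasDerivAt_deriv t).fun_neg.congr_deriv (by ring))

theorem comp_const_sub (hv : IsDuffing c v) (s : ℝ) : IsDuffing c fun t => v (s - t) :=
  of_hasDerivAt (v' := fun t => -deriv v (s - t))
    (fun t => (hv.hasDerivAt (s - t)).comp_const_sub s t)
    (fun t => ((hv.hasDerivAt_deriv (s - t)).comp_const_sub s t).fun_neg.congr_deriv (by ring))

theorem eq_zero (hv : IsDuffing c v) {t₀ : ℝ} (h0 : v t₀ = 0) (h1 : deriv v t₀ = 0) :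
    v = fun _ => 0 := by
  refine hv.unique (of_hasDerivAt (v' := fun _ => 0) (fun t => hasDerivAt_const _ _)
    (fun t => by simpa using hasDerivAt_const t (0:ℝ))) h0 (by simp [h1])

/-- The reflected function `t ↦ -v (2z - t)` solves the same equation with the same data at `z`. -/
theorem antisymm_of_zero (hv : IsDuffing c v) {z : ℝ} (hz : v z = 0) (t : ℝ) :
    v (z - t) = -v (z + t) := by
  have := (hv.comp_const_sub (2 * z)).neg.unique hv (t₀ := z) (by simp [two_mul, hz]) (by
    have := (((hv.hasDerivAt (2 * z - z)).comp_const_sub (2 * z) z).fun_neg).deriv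
    rw [this]
    simp [two_mul])
  have := congrFun this (z + t)
  simp only [show 2 * z - (z + t) = z - t by ring] at this
  linarith

/-- A `2π`-periodic solution of `v'' + v = v³` with a zero vanishes identically. -/
theorem eq_zero_of_periodic (hv : IsDuffing 1 v) (hp : Function.Periodic v (2 * π)) {z : ℝ}
    (hz : v z = 0) : v = fun _ => 0 := by
  by_contra hne
  wlog hd : 0 < deriv v z generalizing v
  · have hd' : deriv v z ≠ 0 := fun h => hne (hv.eq_zero hz h)
    refine this hv.neg (fun t => by simp [hp t]) (by simp [hz]) (fun h => hne ?_) ?_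
    · funext t; simpa using congrFun h t
    · rw [deriv.fun_neg]
      have := lt_of_le_of_ne (not_lt.1 hd) hd'
      linarith
  have hvc : Continuous v := hv.1.continuous
  -- Oddness about `z` makes `v (z - π)` and `v (z + π)` opposite, periodicity makes them equal.
  have hzπ : v (z + π) = 0 := by
    have h1 := hv.antisymm_of_zero hz π
    have h2 := hp (z - π)
    rw [show z - π + 2 * π = z + π by ring] at h2
    linarith
  -- the first zero after `z`
  obtain ⟨δ, hδ, hδpos⟩ : ∃ δ > 0, ∀ t ∈ Ioo z (z + δ), 0 < v t := by
    have h1 : ∀ᶠ t in 𝓝[>] z, 0 < slope v z t :=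
      ((hasDerivWithinAt_iff_tendsto_slope' self_notMem_Ioi).1 (hv.hasDerivAt z).hasDerivWithinAt).eventually_const_lt hd
    obtain ⟨y, hy, hy'⟩ := mem_nhdsGT_iff_exists_Ioo_subset.1 h1
    refine ⟨y - z, sub_pos.2 hy, fun t ht => ?_⟩
    have h2 : 0 < slope v z t := hy' ⟨ht.1, by linarith [ht.2]⟩
    rw [slope_def_field, hz, sub_zero] at h2
    exact (div_pos_iff_of_pos_right (sub_pos.2 ht.1)).1 h2
  -- Starting at `z + δ / 2` keeps `z` itself out of this compact set, so its least element is the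
  -- first zero after `z`, at distance at most `π`.
  let S : Set ℝ := Icc (z + δ / 2) (z + π) ∩ v ⁻¹' Iic 0
  have hδπ : δ ≤ π := by
    by_contra! h
    exact absurd (hδpos (z + π) ⟨by linarith [pi_pos], by linarith⟩) (by simp [hzπ])
  have hSc : IsCompact S := isCompact_Icc.inter_right (isClosed_Iic.preimage hvc)
  have hSne : S.Nonempty := ⟨z + π, ⟨by linarith, le_rfl⟩, by simp [hzπ]⟩
  obtain ⟨y, hyS, hy⟩ := hSc.exists_isLeast hSne
  have hyz : z < y := by linarith [hyS.1.1]
  have hpos : ∀ t ∈ Ioo z y, 0 < v t := by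
    intro t ht
    by_cases h : t < z + δ
    · exact hδpos t ⟨ht.1, h⟩
    · by_contra! h'
      exact absurd (hy ⟨⟨by linarith, by linarith [ht.2, hyS.1.2]⟩, h'⟩) (not_le.2 ht.2)
  have hy0 : v y = 0 := by
    refine le_antisymm hyS.2 ?_
    have : y ∈ closure (Ioo z y) := by
      rw [closure_Ioo hyz.ne]; exact ⟨hyz.le, le_rfl⟩
    exact closure_minimal (fun t ht => (hpos t ht).le) (isClosed_Ici.preimage hvc) this
  -- The Wronskian with `sin (t - z)`: its derivative `v³ sin (t - z)` is positive between the two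
  -- zeros, yet `W z = 0` and `W y = v'(y) sin (y - z) ≤ 0`.
  let W : ℝ → ℝ := fun t => deriv v t * sin (t - z) - v t * cos (t - z)
  have hW : ∀ t, HasDerivAt W (v t ^ 3 * sin (t - z)) t := by
    intro t
    have hs : HasDerivAt (fun t => sin (t - z)) (cos (t - z)) t :=
      (hasDerivAt_sin (t - z)).comp_sub_const t z
    have hc : HasDerivAt (fun t => cos (t - z)) (-sin (t - z)) t :=
      (hasDerivAt_cos (t - z)).comp_sub_const t z
    exact (((hv.hasDerivAt_deriv t).fun_mul hs).fun_sub
      ((hv.hasDerivAt t).fun_mul hc)).congr_deriv (by ring)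
  have hmono : StrictMonoOn W (Icc z y) := by
    refine strictMonoOn_of_deriv_pos (convex_Icc _ _)
      (fun t _ => (hW t).continuousAt.continuousWithinAt) fun t ht => ?_
    rw [interior_Icc] at ht
    rw [(hW t).deriv]
    have := hpos t ht
    have := sin_pos_of_pos_of_lt_pi (sub_pos.2 ht.1) (by linarith [ht.2, hyS.1.2])
    positivity
  have hlt := hmono ⟨le_rfl, hyz.le⟩ ⟨hyz.le, le_rfl⟩ hyz
  have hdy : deriv v y ≤ 0 := by
    by_contra! h
    have h1 : ∀ᶠ t in 𝓝[<] y, 0 < slope v y t :=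
      ((hasDerivWithinAt_iff_tendsto_slope' self_notMem_Iio).1 (hv.hasDerivAt y).hasDerivWithinAt).eventually_const_lt h
    obtain ⟨t, ht, ht'⟩ := (h1.and (Ioo_mem_nhdsLT hyz)).exists
    have := hpos t ht'
    rw [slope_def_field, hy0, sub_zero] at ht
    exact absurd ht (not_lt.2 (div_nonpos_of_nonneg_of_nonpos this.le (by linarith [ht'.2])))
  have hsin : 0 ≤ sin (y - z) := sin_nonneg_of_nonneg_of_le_pi (by linarith) (by linarith [hyS.1.2])
  simp only [W, hz, hy0, sub_self, sin_zero] at hlt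
  nlinarith

/-- A `2π`-periodic solution of `v'' + v = v³` is constant. -/
theorem const_of_periodic (hv : IsDuffing 1 v) (hp : Function.Periodic v (2 * π)) (s t : ℝ) :
    v s = v t := by
  by_cases hz : ∃ z, v z = 0
  · obtain ⟨z, hz⟩ := hz
    simp [hv.eq_zero_of_periodic hp hz]
  push Not at hz
  wlog h0 : 0 < v 0 generalizing v
  · have := this hv.neg (fun t => by simp [hp t]) (by simpa using hz)
      (by have := lt_of_le_of_ne (not_lt.1 h0) (hz 0); simpa using this)
    simpa using this
  have hvc : Continuous v := hv.1.continuous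
  have hpos : ∀ t, 0 < v t := by
    intro t
    by_contra! h
    obtain ⟨y, hy⟩ := mem_range_of_exists_le_of_exists_ge hvc ⟨t, h⟩ ⟨0, h0.le⟩
    exact hz y hy
  obtain ⟨M, -, hM⟩ := (isCompact_Icc (a := 0) (b := 2 * π)).exists_isMaxOn
    (nonempty_Icc.2 two_pi_pos.le) hvc.continuousOn
  obtain ⟨m, -, hm⟩ := (isCompact_Icc (a := 0) (b := 2 * π)).exists_isMinOn
    (nonempty_Icc.2 two_pi_pos.le) hvc.continuousOn
  have hM' : ∀ t, v t ≤ v M := fun t => by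
    obtain ⟨y, hy, e⟩ := hp.exists_mem_Ico₀ two_pi_pos t
    rw [e]; exact hM (Ico_subset_Icc_self hy)
  have hm' : ∀ t, v m ≤ v t := fun t => by
    obtain ⟨y, hy, e⟩ := hp.exists_mem_Ico₀ two_pi_pos t
    rw [e]; exact hm (Ico_subset_Icc_self hy)
  have hdM : deriv v M = 0 := IsLocalMax.deriv_eq_zero (Eventually.of_forall hM')
  have hdm : deriv v m = 0 := IsLocalMin.deriv_eq_zero (Eventually.of_forall hm')
  -- If `v M > 1` then `v'' = v³ - v > 0` at the maximum, so `M` is also a local minimum, `v` is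
  -- locally constant and `v'' = 0` there. The minimum is treated symmetrically.
  have h1 : v M ≤ 1 := by
    by_contra! h
    have hd : 0 < deriv (deriv v) M := by
      rw [(hv.hasDerivAt_deriv M).deriv]; nlinarith [mul_pos (hpos M) (sub_pos.2 h)]
    have hmin : IsLocalMin v M :=
      isLocalMin_of_deriv_deriv_pos hd hdM hvc.continuousAt
    have he : v =ᶠ[𝓝 M] fun _ => v M := hmin.mono fun t ht => le_antisymm (hM' t) ht
    have := he.deriv.deriv.eq_of_nhds
    simp at this
    linarith
  have h2 : 1 ≤ v m := by
    by_contra! h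
    have hm0 := hpos m
    have hd : deriv (deriv v) m < 0 := by
      rw [(hv.hasDerivAt_deriv m).deriv]; nlinarith [mul_pos hm0 (sub_pos.2 h)]
    have hmax : IsLocalMax v m :=
      isLocalMax_of_deriv_deriv_neg hd hdm hvc.continuousAt
    have he : v =ᶠ[𝓝 m] fun _ => v m := hmax.mono fun t ht => le_antisymm ht (hm' t)
    have := he.deriv.deriv.eq_of_nhds
    simp at this
    linarith
  linarith [hM' s, hM' t, hm' s, hm' t]

end IsDuffing

/-! ### Explicit solutions of `w'' + w = -w³` in phase-amplitude form -/

/-- The angular speed of the phase of the solution of amplitude `a`. -/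
def speed (a φ : ℝ) : ℝ := √(1 + a ^ 2 * (1 + sin φ ^ 2) / 2)

/-- The time at which the solution of amplitude `a` reaches the phase `φ`. -/
def phaseTime (a φ : ℝ) : ℝ := ∫ s in (0 : ℝ)..φ, (speed a s)⁻¹

/-- The half-period of the solution of amplitude `a`. -/
def halfPeriod (a : ℝ) : ℝ := phaseTime a π

theorem speed_pos (a φ : ℝ) : 0 < speed a φ := sqrt_pos.2 (by positivity)

theorem speed_sq (a φ : ℝ) : speed a φ ^ 2 = 1 + a ^ 2 * (1 + sin φ ^ 2) / 2 :=
  sq_sqrt (by positivity)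

theorem continuous_speed_uncurry : Continuous fun p : ℝ × ℝ => speed p.1 p.2 := by
  unfold speed; fun_prop

theorem continuous_speed (a : ℝ) : Continuous (speed a) :=
  continuous_speed_uncurry.comp (by fun_prop : Continuous fun φ : ℝ => (a, φ))

theorem continuous_inv_speed (a : ℝ) : Continuous fun φ => (speed a φ)⁻¹ :=
  (continuous_speed a).inv₀ fun φ => (speed_pos a φ).ne'

theorem speed_add_pi (a φ : ℝ) : speed a (φ + π) = speed a φ := by
  simp [speed, sin_add_pi]

theorem hasDerivAt_speed (a φ : ℝ) :
    HasDerivAt (speed a) (a ^ 2 * sin φ * cos φ / (2 * speed a φ)) φ := by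
  have h : HasDerivAt (fun φ => 1 + a ^ 2 * (1 + sin φ ^ 2) / 2) (a ^ 2 * (sin φ * cos φ)) φ :=
    (((((hasDerivAt_sin φ).fun_pow 2).const_add 1).const_mul (a ^ 2)).div_const 2
      |>.const_add 1).congr_deriv (by push_cast; ring)
  exact (h.sqrt (by positivity)).congr_deriv (by unfold speed; ring)

theorem hasDerivAt_phaseTime (a φ : ℝ) : HasDerivAt (phaseTime a) (speed a φ)⁻¹ φ :=
  (continuous_inv_speed a).integral_hasStrictDerivAt 0 φ |>.hasDerivAt

theorem continuous_phaseTime (a : ℝ) : Continuous (phaseTime a) :=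
  continuous_iff_continuousAt.2 fun φ => (hasDerivAt_phaseTime a φ).continuousAt

theorem strictMono_phaseTime (a : ℝ) : StrictMono (phaseTime a) :=
  strictMono_of_deriv_pos fun φ => by
    rw [(hasDerivAt_phaseTime a φ).deriv]; exact inv_pos.2 (speed_pos a φ)

theorem phaseTime_zero (a : ℝ) : phaseTime a 0 = 0 := by simp [phaseTime]

theorem halfPeriod_pos (a : ℝ) : 0 < halfPeriod a := by
  rw [halfPeriod, ← phaseTime_zero a]; exact strictMono_phaseTime a pi_pos

theorem phaseTime_add_pi (a φ : ℝ) : phaseTime a (φ + π) = phaseTime a φ + halfPeriod a := by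
  have hp : Function.Periodic (fun s => (speed a s)⁻¹) π := fun s => by simp [speed_add_pi]
  have h1 := hp.intervalIntegral_add_eq φ 0
  rw [zero_add] at h1
  rw [halfPeriod, phaseTime, phaseTime, phaseTime, ← h1,
    intervalIntegral.integral_add_adjacent_intervals] <;>
  exact (continuous_inv_speed a).intervalIntegrable _ _

theorem phaseTime_add_int_mul_pi (a φ : ℝ) (n : ℤ) :
    phaseTime a (φ + n * π) = phaseTime a φ + n * halfPeriod a := by
  induction n with
  | zero => simp
  | succ n ih =>
    have := phaseTime_add_pi a (φ + n * π)
    push_cast at ih ⊢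
    rw [add_mul, one_mul, ← add_assoc, this, ih]; ring
  | pred n ih =>
    have := phaseTime_add_pi a (φ + (-n - 1) * π)
    push_cast at ih ⊢
    rw [show φ + (-(n : ℝ) - 1) * π + π = φ + -n * π by ring, ih] at this
    linarith

theorem surjective_phaseTime (a : ℝ) : Function.Surjective (phaseTime a) := by
  intro t
  have hP := halfPeriod_pos a
  refine mem_range_of_exists_le_of_exists_ge (continuous_phaseTime a)
    ⟨⌊t / halfPeriod a⌋ * π, ?_⟩ ⟨⌈t / halfPeriod a⌉ * π, ?_⟩
  · have := phaseTime_add_int_mul_pi a 0 ⌊t / halfPeriod a⌋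
    rw [zero_add, phaseTime_zero, zero_add] at this
    rw [this, ← le_div_iff₀ hP]
    exact Int.floor_le _
  · have := phaseTime_add_int_mul_pi a 0 ⌈t / halfPeriod a⌉
    rw [zero_add, phaseTime_zero, zero_add] at this
    rw [this, ← div_le_iff₀ hP]
    exact Int.le_ceil _

/-- The phase at time `t` of the solution of amplitude `a`. -/
def phase (a : ℝ) : ℝ ≃o ℝ :=
  ((strictMono_phaseTime a).orderIsoOfSurjective _ (surjective_phaseTime a)).symm

theorem phaseTime_phase (a t : ℝ) : phaseTime a (phase a t) = t :=
  ((strictMono_phaseTime a).orderIsoOfSurjective _ (surjective_phaseTime a)).apply_symm_apply t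

theorem phase_phaseTime (a φ : ℝ) : phase a (phaseTime a φ) = φ :=
  ((strictMono_phaseTime a).orderIsoOfSurjective _ (surjective_phaseTime a)).symm_apply_apply φ

theorem phase_add_int_mul (a t : ℝ) (n : ℤ) :
    phase a (t + n * halfPeriod a) = phase a t + n * π := by
  conv_lhs => rw [← phaseTime_phase a t, ← phaseTime_add_int_mul_pi, phase_phaseTime]

theorem hasDerivAt_phase (a t : ℝ) : HasDerivAt (phase a) (speed a (phase a t)) t := by
  have := (hasDerivAt_phaseTime a (phase a t)).of_local_left_inverse
    (phase a).continuous.continuousAt (inv_pos.2 (speed_pos _ _)).ne'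
    (Eventually.of_forall (phaseTime_phase a))
  rwa [inv_inv] at this

/-- The solution of `w'' + w = -w³` of amplitude `a` that vanishes at `0`. -/
def wave (a t : ℝ) : ℝ := a * sin (phase a t)

theorem hasDerivAt_wave (a t : ℝ) :
    HasDerivAt (wave a) (a * cos (phase a t) * speed a (phase a t)) t :=
  (((hasDerivAt_sin _).comp t (hasDerivAt_phase a t)).const_mul a).congr_deriv (by ring)

/-- Differentiating `a cos φ · speed` along `φ' = speed` leaves the square root only squared or
cancelled, so a polynomial identity in `sin φ`, `cos φ` remains. -/
theorem isDuffing_wave (a : ℝ) : IsDuffing (-1) (wave a) := by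
  refine .of_hasDerivAt (hasDerivAt_wave a) fun t => ?_
  have h := (((hasDerivAt_cos _).comp t (hasDerivAt_phase a t)).const_mul a).mul
    ((hasDerivAt_speed a _).comp t (hasDerivAt_phase a t))
  refine h.congr_deriv ?_
  have hs := speed_pos a (phase a t)
  have hsq := speed_sq a (phase a t)
  have hc := sin_sq_add_cos_sq (phase a t)
  simp only [Function.comp, wave]
  set σ := speed a (phase a t)
  set x := sin (phase a t)
  set y := cos (phase a t)
  have e : a ^ 2 * x * y / (2 * σ) * σ = a ^ 2 * x * y / 2 := by field_simp
  rw [e]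
  have hy : y ^ 2 = 1 - x ^ 2 := by linarith
  linear_combination (-(a * x)) * hsq + (a ^ 3 * x / 2) * hy

theorem wave_zero (a : ℝ) : wave a 0 = 0 := by
  have : phase a 0 = 0 := by
    conv_lhs => rw [← phaseTime_zero a, phase_phaseTime]
  simp [wave, this]

theorem wave_add_int_mul (a t : ℝ) (n : ℤ) :
    wave a (t + n * halfPeriod a) = (-1) ^ n * wave a t := by
  rw [wave, phase_add_int_mul, sin_add_int_mul_pi, wave]; ring

theorem eq_int_mul_of_wave_eq_zero {a t : ℝ} (ha : a ≠ 0) (h : wave a t = 0) :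
    ∃ n : ℤ, t = n * halfPeriod a := by
  obtain ⟨n, hn⟩ := sin_eq_zero_iff.1 ((mul_eq_zero.1 h).resolve_left ha)
  refine ⟨n, ?_⟩
  have := phaseTime_add_int_mul_pi a 0 n
  rw [zero_add, phaseTime_zero, zero_add, hn, phaseTime_phase] at this
  exact this

theorem wave_ne_zero {a : ℝ} (ha : a ≠ 0) : ∃ t, wave a t ≠ 0 :=
  ⟨phaseTime a (π / 2), by simp [wave, phase_phaseTime, ha]⟩

/-- A period carries the zero `0` to another zero, hence is a multiple of the half-period; odd
multiples reverse the sign. -/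
theorem periodic_wave_iff {a S : ℝ} (ha : a ≠ 0) :
    Function.Periodic (wave a) S ↔ ∃ m : ℤ, S = m * (2 * halfPeriod a) := by
  constructor
  · intro h
    obtain ⟨n, rfl⟩ := eq_int_mul_of_wave_eq_zero ha
      (show wave a S = 0 by have := h 0; rwa [zero_add, wave_zero] at this)
    obtain ⟨t, ht⟩ := wave_ne_zero ha
    have h1 := h t
    rw [wave_add_int_mul] at h1
    rcases Int.even_or_odd n with hn | hn
    · obtain ⟨m, rfl⟩ := hn
      exact ⟨m, by push_cast; ring⟩
    · rw [hn.neg_one_zpow] at h1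
      exact absurd (by linarith) ht
  · rintro ⟨m, rfl⟩ t
    have := wave_add_int_mul a t (2 * m)
    rw [(even_two_mul m).neg_one_zpow, one_mul] at this
    rw [← this]; push_cast; ring_nf

theorem isLeastPeriod_wave {a : ℝ} (ha : a ≠ 0) : IsLeastPeriod (wave a) (2 * halfPeriod a) := by
  have hP := halfPeriod_pos a
  refine ⟨⟨by positivity, (periodic_wave_iff ha).2 ⟨1, by simp⟩⟩, ?_⟩
  rintro S ⟨hS, hp⟩
  obtain ⟨m, rfl⟩ := (periodic_wave_iff ha).1 hp
  have hm : 0 < (m : ℝ) := pos_of_mul_pos_left hS (by positivity)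
  have : (1 : ℝ) ≤ m := by exact_mod_cast hm
  nlinarith

/-! ### The period as a function of the amplitude -/

theorem speed_lt_speed {a b : ℝ} (ha : 0 ≤ a) (h : a < b) (φ : ℝ) : speed a φ < speed b φ := by
  refine sqrt_lt_sqrt (by positivity) ?_
  have : a ^ 2 < b ^ 2 := by gcongr
  have : 0 < 1 + sin φ ^ 2 := by positivity
  nlinarith

theorem halfPeriod_strictAntiOn : StrictAntiOn halfPeriod (Ici 0) := by
  intro a ha b _ h
  refine intervalIntegral.integral_lt_integral_of_continuousOn_of_le_of_exists_lt pi_pos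
    (continuous_inv_speed b).continuousOn (continuous_inv_speed a).continuousOn
    (fun φ _ => ?_) ⟨0, ⟨le_rfl, pi_pos.le⟩, ?_⟩
  · exact inv_anti₀ (speed_pos a φ) (speed_lt_speed ha h φ).le
  · exact inv_strictAnti₀ (speed_pos a 0) (speed_lt_speed ha h 0)

theorem continuous_halfPeriod : Continuous halfPeriod :=
  intervalIntegral.continuous_parametric_intervalIntegral_of_continuous'
    (f := fun a s => (speed a s)⁻¹)
    (continuous_speed_uncurry.inv₀ fun p => (speed_pos p.1 p.2).ne') 0 π

theorem halfPeriod_zero : halfPeriod 0 = π := by simp [halfPeriod, phaseTime, speed]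

theorem halfPeriod_lt_pi {a : ℝ} (ha : 0 < a) : halfPeriod a < π :=
  halfPeriod_zero ▸ halfPeriod_strictAntiOn (mem_Ici.2 le_rfl) (mem_Ici.2 ha.le) ha

theorem halfPeriod_le {a : ℝ} {m : ℝ} (hm : 0 < m) (h : m ^ 2 ≤ 1 + a ^ 2 / 2) :
    halfPeriod a ≤ π / m := by
  have h1 : halfPeriod a ≤ ∫ _ in (0 : ℝ)..π, m⁻¹ := by
    refine intervalIntegral.integral_mono_on pi_pos.le
      ((continuous_inv_speed a).intervalIntegrable _ _) (by simp) fun φ _ => ?_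
    refine inv_anti₀ hm (le_sqrt_of_sq_le (h.trans ?_))
    have := sq_nonneg (a * sin φ)
    nlinarith
  simpa [div_eq_mul_inv] using h1

theorem exists_halfPeriod_eq {k : ℕ} (hk : 2 ≤ k) : ∃ a, 0 < a ∧ halfPeriod a = π / k := by
  have hk' : (2 : ℝ) ≤ k := by exact_mod_cast hk
  -- The amplitude `2k` is just one large enough: `k² ≤ 1 + (2k)²/2`, so the speed is at least `k`.
  have h1 : halfPeriod (2 * k) ≤ π / k := halfPeriod_le (by linarith) (by nlinarith)
  have h2 : π / k < halfPeriod 0 := by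
    rw [halfPeriod_zero]; exact div_lt_self pi_pos (by linarith)
  obtain ⟨a, ha, he⟩ := intermediate_value_Icc' (by positivity : (0 : ℝ) ≤ 2 * k)
    continuous_halfPeriod.continuousOn ⟨h1, h2.le⟩
  refine ⟨a, lt_of_le_of_ne ha.1 ?_, he⟩
  rintro rfl
  linarith

/-! ### Classification of the solutions of `w'' + w = -w³` -/

/-- The amplitude is read off from the energy by solving `a² + a⁴/2 = E` for `a²`. Then `sin φ = x /
a` leaves the choice between `φ` and `π - φ`, settled by the sign of `y`. -/
theorem exists_phase_of_data {x y : ℝ} (h : ¬ (x = 0 ∧ y = 0)) :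
    ∃ a, 0 < a ∧ ∃ φ, a * sin φ = x ∧ a * cos φ * speed a φ = y := by
  set E := y ^ 2 + x ^ 2 + x ^ 4 / 2 with hE
  have hEpos : 0 < E := by
    by_contra! hle
    refine h ⟨?_, ?_⟩ <;> by_contra hne <;>
      nlinarith [sq_nonneg x, sq_nonneg y, sq_nonneg (x ^ 2), pow_pos (sq_pos_of_ne_zero hne) 1]
  have hs1 : 1 < √(1 + 2 * E) := by
    rw [lt_sqrt] <;> linarith
  have hs2 : √(1 + 2 * E) ^ 2 = 1 + 2 * E := sq_sqrt (by linarith)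
  set a := √(√(1 + 2 * E) - 1) with ha
  have hapos : 0 < a := sqrt_pos.2 (by linarith)
  have hasq : a ^ 2 = √(1 + 2 * E) - 1 := sq_sqrt (by linarith)
  have haE : a ^ 2 + a ^ 4 / 2 = E := by
    rw [show a ^ 4 = (a ^ 2) ^ 2 by ring, hasq]; nlinarith
  have hxa : x ^ 2 ≤ a ^ 2 := by
    by_contra! hlt
    nlinarith [sq_nonneg y, sq_nonneg a, sq_nonneg x]
  have habs := abs_le_of_sq_le_sq' hxa hapos.le
  have hsin : sin (arcsin (x / a)) = x / a :=
    sin_arcsin (by rw [le_div_iff₀ hapos]; linarith) (by rw [div_le_iff₀ hapos]; linarith)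
  have hcos := cos_arcsin_nonneg (x / a)
  set φ := arcsin (x / a)
  have hx : a * sin φ = x := by rw [hsin]; field_simp
  have hy : (a * cos φ * speed a φ) ^ 2 = y ^ 2 := by
    have hc : cos φ ^ 2 = 1 - sin φ ^ 2 := by linarith [sin_sq_add_cos_sq φ]
    have : y ^ 2 = a ^ 2 + a ^ 4 / 2 - x ^ 2 - x ^ 4 / 2 := by linarith
    rw [this, ← hx, mul_pow, mul_pow, speed_sq, hc]
    ring
  rcases sq_eq_sq_iff_eq_or_eq_neg.1 hy with h' | h'
  · exact ⟨a, hapos, φ, hx, h'⟩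
  · refine ⟨a, hapos, π - φ, by rwa [sin_pi_sub], ?_⟩
    have : speed a (π - φ) = speed a φ := by simp [speed]
    rw [this, cos_pi_sub]
    linarith

theorem IsDuffing.exists_eq_wave {v : ℝ → ℝ} (hv : IsDuffing (-1) v) (hne : v ≠ fun _ => 0) :
    ∃ a, 0 < a ∧ ∃ s, v = fun t => wave a (t + s) := by
  obtain ⟨a, ha, φ, hx, hy⟩ := exists_phase_of_data (x := v 0) (y := deriv v 0)
    fun h => hne (hv.eq_zero h.1 h.2)
  refine ⟨a, ha, phaseTime a φ,
    hv.unique ((isDuffing_wave a).comp_add_const _) (t₀ := 0) ?_ ?_⟩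
  · simp [wave, phase_phaseTime, hx]
  · rw [((hasDerivAt_wave a (0 + phaseTime a φ)).comp_add_const 0 _).deriv, zero_add,
      phase_phaseTime, hy]

theorem periodic_comp_add_const_iff {v : ℝ → ℝ} {s S : ℝ} :
    Function.Periodic (fun t => v (t + s)) S ↔ Function.Periodic v S := by
  constructor
  · intro h t
    have := h (t - s)
    simpa [add_right_comm] using this
  · intro h t
    simpa [add_right_comm] using h (t + s)

theorem isLeastPeriod_comp_add_const_iff {v : ℝ → ℝ} {s S : ℝ} :
    IsLeastPeriod (fun t => v (t + s)) S ↔ IsLeastPeriod v S := by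
  simp only [IsLeastPeriod, periodic_comp_add_const_iff]

theorem not_isLeastPeriod_const {c T : ℝ} : ¬ IsLeastPeriod (fun _ => c) T := fun h => by
  have := h.2 (show T / 2 ∈ _ from ⟨by linarith [h.1.1], fun _ => rfl⟩)
  linarith [h.1.1]

theorem isModeSolution_iff {k : ℕ} {v : ℝ → ℝ} :
    IsModeSolution k v ↔ IsDuffing (-1) v ∧ IsLeastPeriod v (2 * π / k) := by
  simp only [IsModeSolution, IsDuffing, and_assoc, neg_one_mul]

/-- The amplitude of the solutions with least period `2π/k`. -/
def amplitude (k : ℕ) : ℝ := if hk : 2 ≤ k then (exists_halfPeriod_eq hk).choose else 1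

/-- The default value `1` for `k < 2` lets this hold for every `k`. -/
theorem amplitude_pos (k : ℕ) : 0 < amplitude k := by
  unfold amplitude
  split_ifs with hk
  exacts [(exists_halfPeriod_eq hk).choose_spec.1, one_pos]

theorem halfPeriod_amplitude {k : ℕ} (hk : 2 ≤ k) : halfPeriod (amplitude k) = π / k := by
  rw [amplitude, dif_pos hk]
  exact (exists_halfPeriod_eq hk).choose_spec.2

theorem eq_amplitude {k : ℕ} (hk : 2 ≤ k) {a : ℝ} (ha : 0 < a) (h : halfPeriod a = π / k) :
    a = amplitude k :=
  halfPeriod_strictAntiOn.injOn (mem_Ici.2 ha.le) (mem_Ici.2 (amplitude_pos k).le)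
    (h.trans (halfPeriod_amplitude hk).symm)

/-- The solution of `w'' + w = -w³` of least period `2π/k` that vanishes at `0`. -/
def modeWave (k : ℕ) : ℝ → ℝ := wave (amplitude k)

theorem modeWave_zero (k : ℕ) : modeWave k 0 = 0 := wave_zero _

theorem isDuffing_modeWave (k : ℕ) : IsDuffing (-1) (modeWave k) := isDuffing_wave _

theorem isLeastPeriod_modeWave {k : ℕ} (hk : 2 ≤ k) : IsLeastPeriod (modeWave k) (2 * π / k) := by
  have := isLeastPeriod_wave (amplitude_pos k).ne'
  rwa [halfPeriod_amplitude hk, ← mul_div_assoc] at this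

theorem isModeSolution_modeWave {k : ℕ} (hk : 2 ≤ k) : IsModeSolution k (modeWave k) :=
  isModeSolution_iff.2 ⟨isDuffing_modeWave k, isLeastPeriod_modeWave hk⟩

theorem periodic_modeWave {k : ℕ} (hk : 2 ≤ k) : Function.Periodic (modeWave k) (2 * π) := by
  have := (isLeastPeriod_modeWave hk).1.2.nat_mul k
  have hk0 : (k : ℝ) ≠ 0 := by positivity
  rwa [mul_div_cancel₀ _ hk0] at this

theorem modeWave_injOn : InjOn modeWave {k | 2 ≤ k} := by
  intro k hk j hj h
  have h1 := isLeastPeriod_modeWave hk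
  rw [h] at h1
  have h2 := h1.unique (isLeastPeriod_modeWave hj)
  have hk0 : (0 : ℝ) < k := by have : 0 < k := lt_of_lt_of_le two_pos hk; exact_mod_cast this
  have hj0 : (0 : ℝ) < j := by have : 0 < j := lt_of_lt_of_le two_pos hj; exact_mod_cast this
  have h3 : (k : ℝ) = j := by
    have := two_pi_pos
    field_simp at h2
    linarith
  exact_mod_cast h3

theorem IsModeSolution.exists_eq_modeWave {k : ℕ} (hk : 2 ≤ k) {v : ℝ → ℝ}
    (hv : IsModeSolution k v) : ∃ s, v = fun t => modeWave k (t + s) := by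
  obtain ⟨hd, hp⟩ := isModeSolution_iff.1 hv
  obtain ⟨a, ha, s, rfl⟩ := hd.exists_eq_wave (by rintro rfl; exact not_isLeastPeriod_const hp)
  have h := (isLeastPeriod_comp_add_const_iff.1 hp).unique (isLeastPeriod_wave ha.ne')
  have : a = amplitude k := eq_amplitude hk ha (by rw [mul_div_assoc] at h; linarith)
  exact ⟨s, by rw [modeWave, this]⟩

theorem IsModeSolution.eq_or_eq_neg {k : ℕ} (hk : 2 ≤ k) {v : ℝ → ℝ}
    (hv : IsModeSolution k v) (h0 : v 0 = 0) : v = modeWave k ∨ v = -modeWave k := by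
  obtain ⟨s, rfl⟩ := hv.exists_eq_modeWave hk
  replace h0 : modeWave k s = 0 := by simpa using h0
  obtain ⟨n, rfl⟩ := eq_int_mul_of_wave_eq_zero (amplitude_pos k).ne' h0
  rcases Int.even_or_odd n with hn | hn
  · left; funext t; simp [modeWave, wave_add_int_mul, hn.neg_one_zpow]
  · right; funext t; simp [modeWave, wave_add_int_mul, hn.neg_one_zpow]

theorem IsDuffing.exists_eq_modeWave {v : ℝ → ℝ} (hv : IsDuffing (-1) v)
    (hp : Function.Periodic v (2 * π)) (hne : v ≠ fun _ => 0) :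
    ∃ k, 2 ≤ k ∧ ∃ s, v = fun t => modeWave k (t + s) := by
  obtain ⟨a, ha, s, rfl⟩ := hv.exists_eq_wave hne
  obtain ⟨m, hm⟩ := (periodic_wave_iff ha.ne').1 (periodic_comp_add_const_iff.1 hp)
  have hP := halfPeriod_pos a
  have hPπ := halfPeriod_lt_pi ha
  -- Here `π = m · halfPeriod a` and `0 < halfPeriod a < π`; this excludes `k = 1`.
  have hm1 : (1 : ℝ) < m := by
    by_contra! h
    nlinarith [pi_pos]
  have hm2 : 2 ≤ m := by
    have : (1 : ℤ) < m := by exact_mod_cast hm1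
    omega
  lift m to ℕ using by omega
  have hk : 2 ≤ m := by exact_mod_cast hm2
  refine ⟨m, hk, s, ?_⟩
  rw [modeWave, ← eq_amplitude hk ha]
  have : (0 : ℝ) < m := by positivity
  rw [eq_div_iff this.ne']
  push_cast at hm
  linarith

/-! ### The Laplacian in logarithmic polar coordinates -/

theorem hasDerivAt_exp_add_mul (ζ d : ℂ) (s : ℝ) :
    HasDerivAt (fun s : ℝ => Complex.exp (ζ + s * d)) (Complex.exp (ζ + s * d) * d) s := by
  have h : HasDerivAt (fun s : ℝ => ζ + s * d) d s :=
    ((Complex.ofRealCLM.hasDerivAt.mul_const d).const_add ζ).congr_deriv (by simp)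
  exact h.cexp

/-- The second derivative of `u ∘ exp` along a line of direction `d`. -/
theorem hasDerivAt_deriv_comp_exp {u : ℂ → ℝ} {ζ : ℂ} (d : ℂ) {s : ℝ}
    (hu : ContDiffAt ℝ 2 u (Complex.exp (ζ + s * d))) :
    HasDerivAt (deriv fun s : ℝ => u (Complex.exp (ζ + s * d)))
      (iteratedFDeriv ℝ 2 u (Complex.exp (ζ + s * d))
        ![Complex.exp (ζ + s * d) * d, Complex.exp (ζ + s * d) * d]
        + fderiv ℝ u (Complex.exp (ζ + s * d)) (Complex.exp (ζ + s * d) * d * d)) s := by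
  let γ : ℝ → ℂ := fun s => Complex.exp (ζ + s * d)
  have hγ : ∀ s, HasDerivAt γ (γ s * d) s := hasDerivAt_exp_add_mul ζ d
  have h1 : ∀ᶠ z in 𝓝 (γ s), DifferentiableAt ℝ u z :=
    (hu.eventually (by simp)).mono fun z hz => hz.differentiableAt two_ne_zero
  have h2 : (deriv fun s => u (γ s)) =ᶠ[𝓝 s] fun s => fderiv ℝ u (γ s) (γ s * d) :=
    ((hγ s).continuousAt.eventually h1).mono fun t ht =>
      (ht.hasFDerivAt.comp_hasDerivAt t (hγ t)).deriv
  have h3 : HasFDerivAt (fderiv ℝ u) (fderiv ℝ (fderiv ℝ u) (γ s)) (γ s) :=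
    ((hu.fderiv_right (m := 1) (by norm_num)).differentiableAt one_ne_zero).hasFDerivAt
  have h4 := (h3.comp_hasDerivAt s (hγ s)).clm_apply ((hγ s).mul_const d)
  refine (h4.congr_of_eventuallyEq h2).congr_deriv ?_
  rw [iteratedFDeriv_two_apply]
  simp [γ]

/-- Trace invariance: `z` and `zI` are orthogonal of length `‖z‖`. The mixed terms cancel without
symmetry of `B`. -/
theorem sum_sq_rotate (B : ℂ →L[ℝ] ℂ →L[ℝ] ℝ) (z : ℂ) :
    B z z + B (z * Complex.I) (z * Complex.I) = ‖z‖ ^ 2 * (B 1 1 + B Complex.I Complex.I) := by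
  obtain ⟨x, y⟩ := z
  have e1 : (⟨x, y⟩ : ℂ) = x • (1 : ℂ) + y • Complex.I := by
    apply Complex.ext <;> simp
  have e2 : (⟨x, y⟩ : ℂ) * Complex.I = (-y) • (1 : ℂ) + x • Complex.I := by
    apply Complex.ext <;> simp
  rw [e2, Complex.sq_norm, Complex.normSq_mk, e1]
  simp only [map_add, map_smul, add_apply, smul_apply,
    smul_eq_mul]
  ring

/-- In the coordinate `ζ = ρ + iθ = log z` the Laplacian is `|z|² Δ = ∂ρ² + ∂θ²`. -/
theorem laplacian_log_polar {u : ℂ → ℝ} {ρ θ : ℝ}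
    (hu : ContDiffAt ℝ 2 u (Complex.exp (ρ + θ * Complex.I))) :
    deriv (deriv fun s : ℝ => u (Complex.exp (s + θ * Complex.I))) ρ
      + deriv (deriv fun t : ℝ => u (Complex.exp (ρ + t * Complex.I))) θ
      = exp ρ ^ 2 * Laplacian.laplacian u (Complex.exp (ρ + θ * Complex.I)) := by
  have e1 : (fun s : ℝ => u (Complex.exp (s + θ * Complex.I)))
      = fun s : ℝ => u (Complex.exp (θ * Complex.I + s * 1)) := by
    funext s; rw [mul_one, add_comm]
  have h1 := hasDerivAt_deriv_comp_exp (u := u) (ζ := θ * Complex.I) 1 (s := ρ)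
    (by rwa [mul_one, add_comm])
  have h2 := hasDerivAt_deriv_comp_exp (u := u) (ζ := ρ) Complex.I (s := θ) hu
  rw [e1, h1.deriv, h2.deriv, mul_one, add_comm (θ * Complex.I : ℂ)]
  set z := Complex.exp (ρ + θ * Complex.I) with hz
  have hn : ‖z‖ = exp ρ := by simp [hz, Complex.norm_exp]
  rw [InnerProductSpace.laplacian_eq_iteratedFDeriv_complexPlane]
  have := sum_sq_rotate (fderiv ℝ (fderiv ℝ u) z) z
  simp only [iteratedFDeriv_two_apply, Matrix.cons_val_zero, Matrix.cons_val_one, mul_one]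
  rw [hn] at this
  -- The first-order terms point along `z d²` for `d = 1, I`, so they cancel.
  rw [← this, mul_assoc, Complex.I_mul_I]
  simp
  ring

/-- A function that is `C²` in the coordinate `log z` is `C²`. -/
theorem contDiffAt_of_comp_exp {u V : ℂ → ℝ} {z₀ : ℂ} (hz₀ : z₀ ≠ 0)
    (hV : ContDiffAt ℝ 2 V (Complex.log z₀))
    (h : ∀ᶠ ζ in 𝓝 (Complex.log z₀), u (Complex.exp ζ) = V ζ) : ContDiffAt ℝ 2 u z₀ := by
  -- A branch of the logarithm smooth at `z₀` even on the cut, since the principal branch is used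
  -- only near `1`.
  let L : ℂ → ℂ := fun z => Complex.log (z / z₀) + Complex.log z₀
  have hL0 : L z₀ = Complex.log z₀ := by simp [L, hz₀]
  have hL : ContDiffAt ℝ 2 L z₀ := by
    have h1 : ContDiffAt ℂ 2 Complex.log (z₀ / z₀) :=
      Complex.contDiffAt_log (by simp [hz₀])
    have h2 : ContDiffAt ℂ 2 (fun z : ℂ => z / z₀) z₀ := by fun_prop
    have h3 : ContDiffAt ℂ 2 L z₀ := (ContDiffAt.comp (f := fun z : ℂ => z / z₀) z₀ h1 h2).add contDiffAt_const
    exact h3.restrict_scalars ℝ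
  have hc : ContDiffAt ℝ 2 (fun z => V (L z)) z₀ := ContDiffAt.comp z₀ (by rwa [hL0]) hL
  refine hc.congr_of_eventuallyEq ?_
  have h' : ∀ᶠ z in 𝓝 z₀, u (Complex.exp (L z)) = V (L z) :=
    hL.continuousAt.eventually (by rwa [hL0])
  filter_upwards [h', isOpen_ne.mem_nhds hz₀] with z hz hz0
  rw [← hz, Complex.exp_add, Complex.exp_log (div_ne_zero hz0 hz₀), Complex.exp_log hz₀,
    div_mul_cancel₀ _ hz₀]

/-! ### Polar coordinates of the hyperbolic plane -/

theorem tanh_half_mem {r : ℝ} (hr : 0 < r) : tanh (r / 2) ∈ Ioo (0 : ℝ) 1 :=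
  ⟨by rw [tanh_eq_sinh_div_cosh]; exact div_pos (sinh_pos_iff.2 (by linarith)) (cosh_pos _),
    tanh_lt_one _⟩

theorem polar_eq_exp {r : ℝ} (hr : 0 < r) (θ : ℝ) :
    polar r θ = Complex.exp (log (tanh (r / 2)) + θ * Complex.I) := by
  rw [polar, Complex.exp_add, ← Complex.ofReal_exp, exp_log (tanh_half_mem hr).1]

/-- The geodesic radius `r` as a function of `ρ = log tanh (r / 2)`. -/
def geodesicRadius (ρ : ℝ) : ℝ := 2 * artanh (exp ρ)

theorem exp_mem_of_neg {ρ : ℝ} (hρ : ρ < 0) : exp ρ ∈ Ioo (0 : ℝ) 1 :=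
  ⟨exp_pos ρ, exp_lt_one_iff.2 hρ⟩

theorem geodesicRadius_pos {ρ : ℝ} (hρ : ρ < 0) : 0 < geodesicRadius ρ :=
  mul_pos two_pos (artanh_pos (exp_mem_of_neg hρ))

theorem tanh_geodesicRadius {ρ : ℝ} (hρ : ρ < 0) : tanh (geodesicRadius ρ / 2) = exp ρ := by
  rw [geodesicRadius, mul_div_cancel_left₀ _ two_ne_zero]
  have := exp_mem_of_neg hρ
  exact tanh_artanh ⟨by linarith [this.1], this.2⟩

theorem polar_geodesicRadius {ρ : ℝ} (hρ : ρ < 0) (θ : ℝ) :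
    polar (geodesicRadius ρ) θ = Complex.exp (ρ + θ * Complex.I) := by
  rw [polar, tanh_geodesicRadius hρ, Complex.exp_add, Complex.ofReal_exp]

theorem geodesicRadius_log_tanh (r : ℝ) (hr : 0 < r) :
    geodesicRadius (log (tanh (r / 2))) = r := by
  rw [geodesicRadius, exp_log (tanh_half_mem hr).1, artanh_tanh]; ring

theorem neg_sinh_log_tanh {r : ℝ} (hr : 0 < r) : -sinh (log (tanh (r / 2))) = (sinh r)⁻¹ := by
  have h := (tanh_half_mem hr).1
  have hs : 0 < sinh (r / 2) := sinh_pos_iff.2 (by linarith)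
  have hc := cosh_pos (r / 2)
  rw [sinh_log h, tanh_eq_sinh_div_cosh, show r = 2 * (r / 2) by ring, sinh_two_mul,
    show 2 * (r / 2) / 2 = r / 2 by ring]
  have := cosh_sq (r / 2)
  field_simp
  linarith

theorem sinh_geodesicRadius {ρ : ℝ} (hρ : ρ < 0) : (sinh (geodesicRadius ρ))⁻¹ = -sinh ρ := by
  rw [← neg_sinh_log_tanh (geodesicRadius_pos hρ), tanh_geodesicRadius hρ, log_exp]

/-- Relative to `dρ² + dθ²` the conformal factor is `|z| λ(z) = 2 / (e^(-ρ) - e^ρ)`. -/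
theorem sq_mul_conformalFactor_sq {ρ : ℝ} (hρ : ρ < 0) (θ : ℝ) :
    exp ρ ^ 2 * conformalFactor (Complex.exp (ρ + θ * Complex.I)) ^ 2 = (sinh ρ ^ 2)⁻¹ := by
  have hn : ‖Complex.exp (ρ + θ * Complex.I)‖ = exp ρ := by simp [Complex.norm_exp]
  have h := exp_mem_of_neg hρ
  rw [conformalFactor, hn, sinh_eq, exp_neg]
  have h1 : 1 - exp ρ ^ 2 ≠ 0 := by nlinarith [h.1, h.2]
  have h2 : exp ρ ^ 2 - 1 ≠ 0 := by nlinarith [h.1, h.2]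
  have h3 := h.1.ne'
  field_simp
  ring

/-- The hyperbolic Laplacian in the coordinates `(ρ, θ)`. -/
theorem hypLaplacian_log_polar {u : ℂ → ℝ} {ρ θ : ℝ} (hρ : ρ < 0)
    (hu : ContDiffAt ℝ 2 u (Complex.exp (ρ + θ * Complex.I))) :
    deriv (deriv fun s : ℝ => u (Complex.exp (s + θ * Complex.I))) ρ
      + deriv (deriv fun t : ℝ => u (Complex.exp (ρ + t * Complex.I))) θ
      = (sinh ρ ^ 2)⁻¹ * hypLaplacian u (Complex.exp (ρ + θ * Complex.I)) := by
  rw [laplacian_log_polar hu, hypLaplacian, ← sq_mul_conformalFactor_sq hρ θ]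
  have hne : conformalFactor (Complex.exp (ρ + θ * Complex.I)) ≠ 0 := by
    intro h0
    have := sq_mul_conformalFactor_sq hρ θ
    rw [h0] at this
    have hs : sinh ρ ≠ 0 := (sinh_neg_iff.2 hρ).ne
    simp at this
    exact hs (pow_eq_zero_iff two_ne_zero |>.1 this.symm)
  field_simp

/-! ### Rotationally symmetric domains in the coordinates `(ρ, θ)` -/

/-- The values of `ρ = log |z|` for `z` in the domain. -/
def logRadii (Ω : Set ℂ) : Set ℝ := {ρ | Complex.exp (ρ : ℂ) ∈ Ω}

namespace IsRotSymmDomain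

variable {Ω : Set ℂ}

theorem exp_mem_iff (hΩ : IsRotSymmDomain Ω) {ρ θ : ℝ} :
    Complex.exp (ρ + θ * Complex.I) ∈ Ω ↔ ρ ∈ logRadii Ω := by
  constructor
  · intro h
    have := hΩ.rot_mem _ h (-θ)
    rw [← Complex.exp_add] at this
    simpa [logRadii, add_comm, add_assoc] using this
  · intro h
    have := hΩ.rot_mem _ h θ
    rwa [← Complex.exp_add, add_comm] at this

theorem polar_mem_iff (hΩ : IsRotSymmDomain Ω) {r θ : ℝ} (hr : 0 < r) :
    polar r θ ∈ Ω ↔ log (tanh (r / 2)) ∈ logRadii Ω := by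
  rw [polar_eq_exp hr, hΩ.exp_mem_iff]

theorem neg_of_mem (hΩ : IsRotSymmDomain Ω) {ρ : ℝ} (h : ρ ∈ logRadii Ω) : ρ < 0 := by
  have := hΩ.subset_disc h
  rwa [mem_ball_zero_iff, Complex.norm_exp, Complex.ofReal_re, exp_lt_one_iff] at this

theorem isOpen_logRadii (hΩ : IsRotSymmDomain Ω) : IsOpen (logRadii Ω) :=
  hΩ.isOpen.preimage (by fun_prop : Continuous fun ρ : ℝ => Complex.exp (ρ : ℂ))

theorem norm_mem_iff (hΩ : IsRotSymmDomain Ω) {ρ : ℝ} :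
    exp ρ ∈ norm '' Ω ↔ ρ ∈ logRadii Ω := by
  constructor
  · rintro ⟨z, hz, h⟩
    have h0 : z ≠ 0 := by rintro rfl; simp at h; exact (exp_pos ρ).ne h
    refine (hΩ.exp_mem_iff (θ := z.arg)).1 ?_
    rw [Complex.exp_add, ← Complex.ofReal_exp, ← h, Complex.norm_mul_exp_arg_mul_I]
    exact hz
  · intro h
    exact ⟨_, h, by simp [Complex.norm_exp]⟩

theorem isPreconnected_logRadii (hΩ : IsRotSymmDomain Ω) : IsPreconnected (logRadii Ω) := by
  have h1 : IsPreconnected (norm '' Ω) :=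
    hΩ.isConnected.isPreconnected.image _ continuous_norm.continuousOn
  rw [isPreconnected_iff_ordConnected] at h1 ⊢
  refine ⟨fun a ha b hb c hc => ?_⟩
  rw [← hΩ.norm_mem_iff] at ha hb ⊢
  exact h1.out ha hb ⟨exp_le_exp.2 hc.1, exp_le_exp.2 hc.2⟩

theorem nonempty_logRadii (hΩ : IsRotSymmDomain Ω) : (logRadii Ω).Nonempty := by
  obtain ⟨z, hz, h0⟩ : ∃ z ∈ Ω, z ≠ 0 := by
    by_contra! h
    obtain ⟨z, hz⟩ := hΩ.isConnected.nonempty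
    have hs : Ω = {0} := Set.eq_singleton_iff_unique_mem.2 ⟨h z hz ▸ hz, h⟩
    exact not_isOpen_singleton (0 : ℂ) (hs ▸ hΩ.isOpen)
  refine ⟨log ‖z‖, ?_⟩
  rw [← hΩ.norm_mem_iff, exp_log (norm_pos_iff.2 h0)]
  exact ⟨z, hz, rfl⟩

theorem contDiffAt (hΩ : IsRotSymmDomain Ω) {u : ℂ → ℝ} (hu : ContDiffOn ℝ 2 u (Ω \ {0}))
    {ρ θ : ℝ} (h : ρ ∈ logRadii Ω) : ContDiffAt ℝ 2 u (Complex.exp (ρ + θ * Complex.I)) :=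
  hu.contDiffAt ((hΩ.isOpen.sdiff isClosed_singleton).mem_nhds
    ⟨hΩ.exp_mem_iff.2 h, Complex.exp_ne_zero _⟩)

end IsRotSymmDomain

/-! ### Separation of variables -/

theorem eq_of_forall_mem_finite {s : Set ℝ} (hs : IsPreconnected s) {f : ℝ → ℝ}
    (hf : ContinuousOn f s) {T : Set ℝ} (hT : T.Finite) (h : ∀ x ∈ s, f x ∈ T) {x y : ℝ}
    (hx : x ∈ s) (hy : y ∈ s) : f x = f y := by
  exact hs.constant_of_mapsTo hT.isDiscrete hf h hx hy

/-- Otherwise `w` takes values in some `{0, c, -c}` and is constant by continuity. -/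
theorem exists_abs_ne_abs {w : ℝ → ℝ} (hw : Continuous w) {s t : ℝ} (hst : w s ≠ w t) :
    ∃ x y, w x ≠ 0 ∧ w y ≠ 0 ∧ |w x| ≠ |w y| := by
  by_contra! h
  obtain ⟨x, hx⟩ : ∃ x, w x ≠ 0 := by
    by_contra! h0
    exact hst (by rw [h0 s, h0 t])
  refine hst (eq_of_forall_mem_finite isPreconnected_univ hw.continuousOn
    (T := {0, w x, -w x}) (by simp) (fun y _ => ?_) (mem_univ s) (mem_univ t))
  by_cases hy : w y = 0
  · simp [hy]
  · rcases abs_eq_abs.1 (h y x hy hx) with h' | h' <;> simp [h']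

theorem mul_mul_abs_rpow (a b p : ℝ) :
    a * b * |a * b| ^ p = a * |a| ^ p * (b * |b| ^ p) := by
  rw [abs_mul, mul_rpow (abs_nonneg _) (abs_nonneg _)]; ring

section Separation

variable {I : Set ℝ} {H w : ℝ → ℝ} {ε q : ℝ}

/-- If `A(ρ) w + w'' = B(ρ) w |w|^p` with `w` non-constant, then `A` and `B` are constant. -/
theorem coefficients_eq {g : ℝ → ℝ} {A A' B B' p x y : ℝ} (hp : p ≠ 0)
    (hx : w x ≠ 0) (hy : w y ≠ 0) (hxy : |w x| ≠ |w y|)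
    (h : ∀ θ, A * w θ + g θ = B * (w θ * |w θ| ^ p))
    (h' : ∀ θ, A' * w θ + g θ = B' * (w θ * |w θ| ^ p)) : A = A' ∧ B = B' := by
  have key : ∀ θ, w θ ≠ 0 → A - A' = (B - B') * |w θ| ^ p := fun θ hθ =>
    mul_left_cancel₀ hθ (by linear_combination h θ - h' θ)
  have hne : |w x| ^ p ≠ |w y| ^ p := fun e =>
    hxy ((rpow_left_inj (abs_nonneg _) (abs_nonneg _) hp).1 e)
  have hB : (B - B') * (|w x| ^ p - |w y| ^ p) = 0 := by
    linear_combination key y hy - key x hx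
  have hB' : B - B' = 0 := (mul_eq_zero.1 hB).resolve_right (sub_ne_zero.2 hne)
  refine ⟨?_, sub_eq_zero.1 hB'⟩
  have := key x hx
  rw [hB', zero_mul] at this
  exact sub_eq_zero.1 this

/-- The radial factor satisfies `H'' = A H` and `|H|^p = K sinh²` where it does not vanish, and
this determines the exponent. -/
theorem exponent_eq_two {N : Set ℝ} (hN : IsOpen N) (hneg : ∀ ρ ∈ N, ρ < 0)
    (hH : ∀ ρ ∈ N, ContDiffAt ℝ 2 H ρ) (h0 : ∀ ρ ∈ N, H ρ ≠ 0) {p A K : ℝ} (hp : p ≠ 0)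
    (hA : ∀ ρ ∈ N, deriv (deriv H) ρ = A * H ρ) (hK : ∀ ρ ∈ N, |H ρ| ^ p = K * sinh ρ ^ 2)
    {ρ₀ : ℝ} (hρ₀ : ρ₀ ∈ N) : p = 2 ∧ A = 1 := by
  have hs : ∀ ρ ∈ N, sinh ρ < 0 := fun ρ hρ => sinh_neg_iff.2 (hneg ρ hρ)
  have hKne : K ≠ 0 := by
    rintro rfl
    have := hK ρ₀ hρ₀
    have h2 := rpow_pos_of_pos (abs_pos.2 (h0 ρ₀ hρ₀)) p
    rw [this, zero_mul] at h2
    exact lt_irrefl _ h2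
  -- `Real.log` ignores signs, so this is about `|H|` and `|sinh ρ|`.
  have hlog : ∀ ρ ∈ N, p * log (H ρ) = log K + 2 * log (sinh ρ) := by
    intro ρ hρ
    have := congrArg log (hK ρ hρ)
    rw [log_rpow (abs_pos.2 (h0 ρ hρ)), log_abs, log_mul hKne (pow_ne_zero 2 (hs ρ hρ).ne),
      log_pow] at this
    exact_mod_cast this
  have hd : ∀ ρ ∈ N, HasDerivAt H (deriv H ρ) ρ := fun ρ hρ =>
    ((hH ρ hρ).differentiableAt two_ne_zero).hasDerivAt
  have hdd : ∀ ρ ∈ N, HasDerivAt (deriv H) (A * H ρ) ρ := fun ρ hρ => by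
    rw [← hA ρ hρ]
    exact (((hH ρ hρ).fderiv_right (m := 1) (by norm_num)).differentiableAt
      one_ne_zero).clm_apply (differentiableAt_const 1) |>.hasDerivAt
  have h1 : ∀ ρ ∈ N, p * (deriv H ρ * sinh ρ) = 2 * (cosh ρ * H ρ) := by
    intro ρ hρ
    have e1 := ((hd ρ hρ).log (h0 ρ hρ)).const_mul p
    have e2 := (((hasDerivAt_sinh ρ).log (hs ρ hρ).ne).const_mul 2).const_add (log K)
    have e3 := e1.unique (e2.congr_of_eventuallyEq
      ((hN.eventually_mem hρ).mono hlog))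
    have := h0 ρ hρ
    have := (hs ρ hρ).ne
    field_simp at e3
    linarith
  have h2 : ∀ ρ ∈ N, p * (A * H ρ * sinh ρ + deriv H ρ * cosh ρ)
      = 2 * (sinh ρ * H ρ + cosh ρ * deriv H ρ) := by
    intro ρ hρ
    have e1 := ((hdd ρ hρ).fun_mul (hasDerivAt_sinh ρ)).const_mul p
    have e2 := ((hasDerivAt_cosh ρ).fun_mul (hd ρ hρ)).const_mul 2
    exact e1.unique (e2.congr_of_eventuallyEq
      ((hN.eventually_mem hρ).mono h1))
  -- Eliminating `H'` between `h1` and its derivative `h2`. Since `sinh²` is not constant on the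
  -- open set `N`, both sides must vanish.
  have h3 : ∀ ρ ∈ N, (p ^ 2 * A - 2 * p - (4 - 2 * p)) * sinh ρ ^ 2 = 4 - 2 * p := by
    intro ρ hρ
    refine mul_left_cancel₀ (h0 ρ hρ) ?_
    linear_combination (p * sinh ρ) * h2 ρ hρ + (2 * cosh ρ - p * cosh ρ) * h1 ρ hρ
      + (4 - 2 * p) * H ρ * cosh_sq ρ
  obtain ⟨ρ₁, hlt, hρ₁⟩ : ∃ ρ₁, ρ₁ < ρ₀ ∧ ρ₁ ∈ N := by
    obtain ⟨x, hx, hx'⟩ := (((hN.eventually_mem hρ₀).filter_mono nhdsWithin_le_nhds).and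
      (self_mem_nhdsWithin : Iio ρ₀ ∈ 𝓝[<] ρ₀)).exists
    exact ⟨x, hx', hx⟩
  have hsne : sinh ρ₀ ^ 2 ≠ sinh ρ₁ ^ 2 := by
    have := sinh_lt_sinh.2 hlt
    have := hs ρ₀ hρ₀
    nlinarith
  have h4 : (p ^ 2 * A - 2 * p - (4 - 2 * p)) * (sinh ρ₀ ^ 2 - sinh ρ₁ ^ 2) = 0 := by
    linear_combination h3 ρ₀ hρ₀ - h3 ρ₁ hρ₁
  have h5 := (mul_eq_zero.1 h4).resolve_right (sub_ne_zero.2 hsne)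
  have h6 := h3 ρ₀ hρ₀
  rw [h5, zero_mul] at h6
  have hp2 : p = 2 := by linarith
  subst hp2
  exact ⟨rfl, by linarith⟩

theorem separated_solution (hI : IsOpen I) (hIc : IsPreconnected I) (hneg : ∀ ρ ∈ I, ρ < 0)
    (hε : ε ≠ 0) (hq : q ≠ 1) (hH : ∀ ρ ∈ I, ContDiffAt ℝ 2 H ρ) (hw : ContDiff ℝ 2 w)
    (heq : ∀ ρ ∈ I, ∀ θ, deriv (deriv H) ρ * w θ + H ρ * deriv (deriv w) θ
      = (sinh ρ ^ 2)⁻¹ * (ε * (H ρ * w θ * |H ρ * w θ| ^ (q - 1))))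
    {ρ₀ : ℝ} (hρ₀ : ρ₀ ∈ I) (hHρ₀ : H ρ₀ ≠ 0) {s t : ℝ} (hst : w s ≠ w t) :
    q = 3 ∧ ∃ C, C ≠ 0 ∧ (∀ ρ ∈ I, H ρ = C * -sinh ρ) ∧ IsDuffing ε fun θ => C * w θ := by
  obtain ⟨x, y, hx, hy, hxy⟩ := exists_abs_ne_abs hw.continuous hst
  have hp : q - 1 ≠ 0 := sub_ne_zero.2 hq
  have hs : ∀ ρ ∈ I, sinh ρ ≠ 0 := fun ρ hρ => (sinh_neg_iff.2 (hneg ρ hρ)).ne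
  have hHc : ContinuousOn H I := fun ρ hρ => (hH ρ hρ).continuousAt.continuousWithinAt
  have hAB : ∀ ρ ∈ I, H ρ ≠ 0 → ∀ θ, deriv (deriv H) ρ / H ρ * w θ + deriv (deriv w) θ
      = (sinh ρ ^ 2)⁻¹ * ε * |H ρ| ^ (q - 1) * (w θ * |w θ| ^ (q - 1)) := by
    intro ρ hρ h0 θ
    have := heq ρ hρ θ
    rw [mul_mul_abs_rpow] at this
    refine mul_left_cancel₀ h0 ?_
    rw [mul_add, ← mul_assoc, mul_div_cancel₀ _ h0, this]
    ring
  set N := I ∩ {ρ | H ρ ≠ 0} with hNdef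
  have hN : IsOpen N := hHc.isOpen_inter_preimage hI isOpen_ne
  set A := deriv (deriv H) ρ₀ / H ρ₀ with hAdef
  set K := (sinh ρ₀ ^ 2)⁻¹ * |H ρ₀| ^ (q - 1) with hKdef
  have hcoef : ∀ ρ ∈ N, deriv (deriv H) ρ = A * H ρ ∧ |H ρ| ^ (q - 1) = K * sinh ρ ^ 2 := by
    rintro ρ ⟨hρ, h0⟩
    obtain ⟨h1, h2⟩ := coefficients_eq hp hx hy hxy (hAB ρ hρ h0) (hAB ρ₀ hρ₀ hHρ₀)
    have h0' : H ρ ≠ 0 := h0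
    refine ⟨by rw [hAdef, ← h1, div_mul_cancel₀ _ h0'], ?_⟩
    have hsρ := hs ρ hρ
    have h3 : (sinh ρ ^ 2)⁻¹ * |H ρ| ^ (q - 1) = K :=
      mul_left_cancel₀ hε (by rw [hKdef]; linear_combination h2)
    rw [← h3]
    field_simp
  obtain ⟨hp2, hA1⟩ := exponent_eq_two hN (fun ρ hρ => hneg ρ hρ.1) (fun ρ hρ => hH ρ hρ.1)
    (fun ρ hρ => hρ.2) hp (fun ρ hρ => (hcoef ρ hρ).1) (fun ρ hρ => (hcoef ρ hρ).2)
    (ρ₀ := ρ₀) ⟨hρ₀, hHρ₀⟩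
  have habs : ∀ a : ℝ, |a| ^ (q - 1) = a ^ 2 := fun a => by rw [hp2, rpow_two, sq_abs]
  simp only [habs] at hcoef hKdef hAB
  set D := H ρ₀ / sinh ρ₀ with hD
  have hDK : D ^ 2 = K := by rw [hD, hKdef, div_pow]; ring
  -- So far `H` is controlled only off its zeros. The continuous quotient takes values in `{0, D,
  -- -D}` on the connected set `I`, so it is constant and `H` never vanishes.
  have hconst : ∀ ρ ∈ I, H ρ / sinh ρ = D := by
    intro ρ hρ
    refine eq_of_forall_mem_finite hIc (f := fun ρ => H ρ / sinh ρ)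
      (hHc.div continuous_sinh.continuousOn hs) (T := {0, D, -D}) (by simp) (fun ρ hρ => ?_) hρ hρ₀
    by_cases h0 : H ρ = 0
    · simp [h0]
    · have : (H ρ / sinh ρ) ^ 2 = D ^ 2 := by
        rw [div_pow, (hcoef ρ ⟨hρ, h0⟩).2, hDK, mul_div_cancel_right₀ _ (pow_ne_zero 2 (hs ρ hρ))]
      rcases sq_eq_sq_iff_eq_or_eq_neg.1 this with h | h <;> simp [h]
  refine ⟨by linarith, -D, neg_ne_zero.2 (div_ne_zero hHρ₀ (hs ρ₀ hρ₀)), fun ρ hρ => ?_, ?_, ?_⟩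
  · rw [← hconst ρ hρ]
    have := hs ρ hρ
    field_simp
  · exact contDiff_const.mul hw
  · intro θ
    have h1 := hAB ρ₀ hρ₀ hHρ₀ θ
    have e : deriv (deriv fun θ => -D * w θ) θ = -D * deriv (deriv w) θ := by
      have : deriv (fun θ => -D * w θ) = fun θ => -D * deriv w θ := by
        funext θ; exact deriv_const_mul_field _
      rw [this, deriv_const_mul_field]
    rw [e]
    rw [← hAdef, hA1, one_mul] at h1
    have h2 : D ^ 2 = (sinh ρ₀ ^ 2)⁻¹ * H ρ₀ ^ 2 := hDK.trans hKdef
    linear_combination (-D) * h1 + ε * (-D) * w θ ^ 3 * (-h2)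

end Separation

/-- Non-radial pseudo-radial solutions exist for the cubic nonlinearity only, and are then of the
form `v(θ) / sinh r`. -/
theorem pseudoRadial_structure {Ω : Set ℂ} (hΩ : IsRotSymmDomain Ω) {ε q : ℝ} (hε : ε ≠ 0)
    (hq : q ≠ 1) {u : ℂ → ℝ} (hu : IsSolution Ω (fun s => ε * (s * |s| ^ (q - 1))) u)
    (hps : IsPseudoRadial Ω u) (hnr : ¬ IsRadial Ω u) :
    q = 3 ∧ ∃ v : ℝ → ℝ, IsDuffing ε v ∧ Function.Periodic v (2 * π) ∧ (∃ s t, v s ≠ v t) ∧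
      ∀ r θ, 0 < r → polar r θ ∈ Ω → u (polar r θ) = v θ / sinh r := by
  obtain ⟨h, w, hwp, hhw⟩ := hps
  have hU : ∀ ρ ∈ logRadii Ω, ∀ θ : ℝ,
      u (Complex.exp (ρ + θ * Complex.I)) = h (geodesicRadius ρ) * w θ := by
    intro ρ hρ θ
    have hρ0 := hΩ.neg_of_mem hρ
    rw [← polar_geodesicRadius hρ0]
    refine hhw _ _ (geodesicRadius_pos hρ0) ?_
    rw [polar_geodesicRadius hρ0]
    exact hΩ.exp_mem_iff.2 hρ
  set H : ℝ → ℝ := fun ρ => h (geodesicRadius ρ) with hHdef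
  obtain ⟨ρ₀, hρ₀, hHρ₀⟩ : ∃ ρ ∈ logRadii Ω, H ρ ≠ 0 := by
    by_contra! h0
    refine hnr ⟨0, fun r θ hr hmem => ?_⟩
    have := h0 _ ((hΩ.polar_mem_iff hr).1 hmem)
    rw [hHdef] at this
    simp only [geodesicRadius_log_tanh r hr] at this
    simp [hhw r θ hr hmem, this]
  obtain ⟨s, t, hst⟩ : ∃ s t, w s ≠ w t := by
    by_contra! h0
    exact hnr ⟨fun r => h r * w 0, fun r θ hr hmem => by rw [hhw r θ hr hmem, h0 θ 0]⟩
  obtain ⟨θ₀, hθ₀⟩ : ∃ θ, w θ ≠ 0 := by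
    by_contra! h0
    exact hst (by rw [h0 s, h0 t])
  have hnhds : ∀ ρ ∈ logRadii Ω, ∀ᶠ x in 𝓝 ρ, x ∈ logRadii Ω := fun ρ hρ =>
    hΩ.isOpen_logRadii.eventually_mem hρ
  -- The factors come with no regularity; each inherits it from `u` by freezing the other variable
  -- where the other factor is nonzero.
  have hw : ContDiff ℝ 2 w := by
    have e : w = fun θ : ℝ => u (Complex.exp (ρ₀ + θ * Complex.I)) / H ρ₀ := by
      funext θ; rw [hU ρ₀ hρ₀, mul_div_cancel_left₀ _ hHρ₀]
    rw [e, contDiff_iff_contDiffAt]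
    intro θ
    have h1 : ContDiffAt ℝ 2 (fun θ : ℝ => Complex.exp (ρ₀ + θ * Complex.I)) θ :=
      (contDiff_const.add (Complex.ofRealCLM.contDiff.mul contDiff_const)).cexp.contDiffAt
    exact (ContDiffAt.comp θ (hΩ.contDiffAt hu.1 hρ₀) h1).div_const _
  have hH : ∀ ρ ∈ logRadii Ω, ContDiffAt ℝ 2 H ρ := by
    intro ρ hρ
    have e : H =ᶠ[𝓝 ρ] fun ρ : ℝ => u (Complex.exp (ρ + θ₀ * Complex.I)) / w θ₀ :=
      (hnhds ρ hρ).mono fun x hx => by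
        beta_reduce
        rw [hU x hx, mul_div_cancel_right₀ _ hθ₀]
    have h1 : ContDiffAt ℝ 2 (fun ρ : ℝ => Complex.exp (ρ + θ₀ * Complex.I)) ρ :=
      (Complex.ofRealCLM.contDiff.add contDiff_const).cexp.contDiffAt
    exact ((ContDiffAt.comp ρ (hΩ.contDiffAt hu.1 hρ) h1).div_const _).congr_of_eventuallyEq e
  have heq : ∀ ρ ∈ logRadii Ω, ∀ θ, deriv (deriv H) ρ * w θ + H ρ * deriv (deriv w) θ
      = (sinh ρ ^ 2)⁻¹ * (ε * (H ρ * w θ * |H ρ * w θ| ^ (q - 1))) := by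
    intro ρ hρ θ
    have hl := hypLaplacian_log_polar (hΩ.neg_of_mem hρ) (hΩ.contDiffAt hu.1 hρ (θ := θ))
    rw [hu.2 _ ⟨hΩ.exp_mem_iff.2 hρ, Complex.exp_ne_zero _⟩, hU ρ hρ] at hl
    rw [← hl]
    congr 1
    · have e : (fun x : ℝ => u (Complex.exp (x + θ * Complex.I))) =ᶠ[𝓝 ρ] fun x => H x * w θ :=
        (hnhds ρ hρ).mono fun x hx => hU x hx θ
      rw [e.deriv.deriv_eq]
      have : deriv (fun x => H x * w θ) = fun x => deriv H x * w θ := by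
        funext x; exact deriv_mul_const_field _
      rw [this, deriv_mul_const_field]
    · have e : (fun x : ℝ => u (Complex.exp (ρ + x * Complex.I))) = fun x => H ρ * w x :=
        funext fun x => hU ρ hρ x
      rw [e]
      have : deriv (fun x => H ρ * w x) = fun x => H ρ * deriv w x := by
        funext x; exact deriv_const_mul_field _
      rw [this, deriv_const_mul_field]
  obtain ⟨hq3, C, hC, hHC, hD⟩ := separated_solution hΩ.isOpen_logRadii hΩ.isPreconnected_logRadii
    (fun ρ hρ => hΩ.neg_of_mem hρ) hε hq hH hw heq hρ₀ hHρ₀ hst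
  refine ⟨hq3, _, hD, fun θ => by simp [hwp θ], ⟨s, t, fun e => hst (mul_left_cancel₀ hC e)⟩, ?_⟩
  intro r θ hr hmem
  have hmem' := (hΩ.polar_mem_iff hr).1 hmem
  have h1 := hHC _ hmem'
  simp only [hHdef, geodesicRadius_log_tanh r hr, neg_sinh_log_tanh hr] at h1
  rw [hhw r θ hr hmem, h1]
  ring

/-- Every `2π`-periodic solution `v` of `v'' + v = -v³` gives the solution `v(θ) / sinh r`. -/
theorem isSolution_of_isDuffing {Ω : Set ℂ} (hΩ : IsRotSymmDomain Ω) {v : ℝ → ℝ}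
    (hv : IsDuffing (-1) v) {u : ℂ → ℝ}
    (hu : ∀ r θ, 0 < r → polar r θ ∈ Ω → u (polar r θ) = v θ / sinh r) :
    IsSolution Ω (fun s => -s ^ 3) u := by
  have hU : ∀ ρ ∈ logRadii Ω, ∀ θ : ℝ,
      u (Complex.exp (ρ + θ * Complex.I)) = v θ * -sinh ρ := by
    intro ρ hρ θ
    have hρ0 := hΩ.neg_of_mem hρ
    rw [← polar_geodesicRadius hρ0, hu _ _ (geodesicRadius_pos hρ0), div_eq_mul_inv,
      sinh_geodesicRadius hρ0]
    rw [polar_geodesicRadius hρ0]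
    exact hΩ.exp_mem_iff.2 hρ
  have hform : ∀ z ≠ 0, z = Complex.exp ((log ‖z‖ : ℝ) + (z.arg : ℝ) * Complex.I) := by
    intro z hz
    conv_lhs => rw [← Complex.exp_log hz]
    rfl
  have hsmooth : ContDiffOn ℝ 2 u (Ω \ {0}) := by
    rintro z ⟨hz, hz0⟩
    have hz0 : z ≠ 0 := hz0
    refine (contDiffAt_of_comp_exp (V := fun ζ => v ζ.im * -sinh ζ.re) hz0 ?_ ?_).contDiffWithinAt
    · have h1 : ContDiff ℝ 2 fun ζ : ℂ => v ζ.im :=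
        hv.1.comp Complex.imCLM.contDiff
      have h2 : ContDiff ℝ 2 fun ζ : ℂ => sinh ζ.re :=
        contDiff_sinh.comp Complex.reCLM.contDiff
      exact (h1.mul h2.neg).contDiffAt
    · have h1 : ∀ᶠ ζ in 𝓝 (Complex.log z), Complex.exp ζ ∈ Ω :=
        Complex.continuous_exp.continuousAt.eventually
          (hΩ.isOpen.mem_nhds (by rwa [Complex.exp_log hz0]))
      refine h1.mono fun ζ hζ => ?_
      have e : ζ = (ζ.re : ℂ) + ζ.im * Complex.I := (Complex.re_add_im ζ).symm
      rw [e] at hζ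
      conv_lhs => rw [e]
      exact hU _ (hΩ.exp_mem_iff.1 hζ) _
  refine ⟨hsmooth, ?_⟩
  rintro z ⟨hz, hz0⟩
  rw [hform z hz0] at hz ⊢
  generalize log ‖z‖ = ρ at *
  generalize z.arg = θ at *
  have hρ := hΩ.exp_mem_iff.1 hz
  have hρ0 := hΩ.neg_of_mem hρ
  have hl := hypLaplacian_log_polar hρ0 (hΩ.contDiffAt hsmooth hρ (θ := θ))
  have e1 : (fun x : ℝ => u (Complex.exp (x + θ * Complex.I))) =ᶠ[𝓝 ρ] fun x => v θ * -sinh x :=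
    (hΩ.isOpen_logRadii.eventually_mem hρ).mono fun x hx => hU x hx θ
  have e2 : (fun x : ℝ => u (Complex.exp (ρ + x * Complex.I))) = fun x => v x * -sinh ρ :=
    funext fun x => hU ρ hρ x
  have d1 : deriv (fun x => v θ * -sinh x) = fun x => v θ * -cosh x := by
    funext x; exact ((hasDerivAt_sinh x).fun_neg.const_mul _).deriv
  have d2 : deriv (fun x => v x * -sinh ρ) = fun x => deriv v x * -sinh ρ := by
    funext x; exact deriv_mul_const_field _
  rw [e1.deriv.deriv_eq, e2, d1, d2, ((hasDerivAt_cosh ρ).fun_neg.const_mul _).deriv,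
    ((hv.hasDerivAt_deriv θ).mul_const _).deriv] at hl
  have hs : sinh ρ ≠ 0 := (sinh_neg_iff.2 hρ0).ne
  rw [hU ρ hρ θ]
  field_simp at hl
  linear_combination -hl

/-- The function `v(θ) / sinh r`. -/
def angularProfile (v : ℝ → ℝ) (z : ℂ) : ℝ := v z.arg / sinh (geodesicRadius (log ‖z‖))

theorem angularProfile_polar {v : ℝ → ℝ} (hv : Function.Periodic v (2 * π)) {r : ℝ} (hr : 0 < r)
    (θ : ℝ) : angularProfile v (polar r θ) = v θ / sinh r := by
  have ht := (tanh_half_mem hr).1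
  have hn : ‖polar r θ‖ = tanh (r / 2) := by
    rw [polar, norm_mul, Complex.norm_exp_ofReal_mul_I, mul_one, Complex.norm_real,
      norm_of_nonneg ht.le]
  have ha : (polar r θ).arg = toIocMod two_pi_pos (-π) θ := by
    rw [polar, Complex.arg_real_mul _ ht, Complex.arg_exp_mul_I]
  rw [angularProfile, hn, geodesicRadius_log_tanh r hr, ha, toIocMod, hv.sub_zsmul_eq]

/-! ### The non-radial pseudo-radial solutions: description and infinitude. -/

theorem mem_nonRadial_of_modeWave {Ω : Set ℂ} (hΩ : IsRotSymmDomain Ω) {k : ℕ} (hk : 2 ≤ k)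
    {θ₀ : ℝ} {u : ℂ → ℝ} (hu : ∀ r θ, 0 < r → polar r θ ∈ Ω →
      u (polar r θ) = modeWave k (θ + θ₀) / sinh r) :
    u ∈ nonRadialPseudoRadialSolutions Ω (fun s => -s ^ 3) := by
  refine ⟨isSolution_of_isDuffing hΩ ((isDuffing_modeWave k).comp_add_const θ₀) hu,
    ⟨fun r => (sinh r)⁻¹, fun θ => modeWave k (θ + θ₀),
      periodic_comp_add_const_iff.2 (periodic_modeWave hk), fun r θ hr hm => ?_⟩, ?_⟩
  · rw [hu r θ hr hm, div_eq_inv_mul]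
  · rintro ⟨f, hf⟩
    obtain ⟨ρ, hρ⟩ := hΩ.nonempty_logRadii
    have hρ0 := hΩ.neg_of_mem hρ
    have hr := geodesicRadius_pos hρ0
    have hmem : ∀ θ, polar (geodesicRadius ρ) θ ∈ Ω := fun θ => by
      rw [polar_geodesicRadius hρ0]; exact hΩ.exp_mem_iff.2 hρ
    have hs := (sinh_pos_iff.2 hr).ne'
    have hc : (fun θ => modeWave k (θ + θ₀)) =
        fun _ => f (geodesicRadius ρ) * sinh (geodesicRadius ρ) := by
      funext θ
      rw [← hf _ θ hr (hmem θ), hu _ θ hr (hmem θ), div_mul_cancel₀ _ hs]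
    have := isLeastPeriod_comp_add_const_iff (s := θ₀) |>.2 (isLeastPeriod_modeWave hk)
    rw [hc] at this
    exact not_isLeastPeriod_const this

theorem exists_modeWave_of_mem {Ω : Set ℂ} (hΩ : IsRotSymmDomain Ω) {u : ℂ → ℝ}
    (hu : u ∈ nonRadialPseudoRadialSolutions Ω (fun s => -s ^ 3)) :
    ∃ k : ℕ, 2 ≤ k ∧ ∃ θ₀ : ℝ, ∀ r θ : ℝ, 0 < r → polar r θ ∈ Ω →
      u (polar r θ) = modeWave k (θ + θ₀) / sinh r := by
  obtain ⟨hsol, hps, hnr⟩ := hu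
  have hF : (fun s : ℝ => -s ^ 3) = fun s => (-1) * (s * |s| ^ ((3 : ℝ) - 1)) := by
    funext s
    rw [show (3 : ℝ) - 1 = 2 by norm_num, rpow_two, sq_abs]; ring
  rw [hF] at hsol
  obtain ⟨-, v, hv, hp, ⟨s, t, hst⟩, huv⟩ :=
    pseudoRadial_structure hΩ (by norm_num) (by norm_num) hsol hps hnr
  obtain ⟨k, hk, θ₀, rfl⟩ := hv.exists_eq_modeWave hp (by rintro rfl; exact hst rfl)
  exact ⟨k, hk, θ₀, huv⟩

/-- Restriction to `Ω \ {0}` discards the arbitrary values of `u` elsewhere, which alone would make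
the set infinite. Different modes already differ on a single circle. -/
theorem infinite_nonRadial {Ω : Set ℂ} (hΩ : IsRotSymmDomain Ω) :
    ((Ω \ {0}).domRestrict '' nonRadialPseudoRadialSolutions Ω (fun s => -s ^ 3)).Infinite := by
  have hinj : InjOn (fun k => (Ω \ {0}).domRestrict (angularProfile (modeWave k))) {k | 2 ≤ k} := by
    intro k hk j hj h
    obtain ⟨ρ, hρ⟩ := hΩ.nonempty_logRadii
    have hρ0 := hΩ.neg_of_mem hρ
    have hr := geodesicRadius_pos hρ0
    have hs := (sinh_pos_iff.2 hr).ne'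
    refine modeWave_injOn hk hj (funext fun θ => ?_)
    have hmem : polar (geodesicRadius ρ) θ ∈ Ω \ {0} := by
      rw [polar_geodesicRadius hρ0]
      exact ⟨hΩ.exp_mem_iff.2 hρ, Complex.exp_ne_zero _⟩
    have := congrFun h ⟨_, hmem⟩
    simp only [domRestrict_apply, angularProfile_polar (periodic_modeWave hk) hr,
      angularProfile_polar (periodic_modeWave hj) hr] at this
    exact (div_left_inj' hs).1 this
  refine ((Set.Ici_infinite 2).image hinj).mono ?_
  rintro _ ⟨k, hk, rfl⟩
  exact ⟨_, mem_nonRadial_of_modeWave hΩ hk (θ₀ := 0)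
    fun r θ hr _ => by rw [angularProfile_polar (periodic_modeWave hk) hr, add_zero], rfl⟩

end HypPlane

end

theorem theorem4p6 (Ω : Set ℂ) (hΩ : HypPlane.IsRotSymmDomain Ω) :
    (∀ ε q : ℝ, (ε = 1 ∨ ε = -1) → 0 < q → q ≠ 1 → (ε = 1 ∨ q ≠ 3) →
      ∀ u : ℂ → ℝ, HypPlane.IsSolution Ω (fun s => ε * (s * |s| ^ (q - 1))) u →
        HypPlane.IsPseudoRadial Ω u → HypPlane.IsRadial Ω u) ∧
    ((Ω \ {0}).domRestrict ''
        HypPlane.nonRadialPseudoRadialSolutions Ω (fun s => -s ^ 3)).Infinite ∧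
    ∃ w : ℕ → ℝ → ℝ,
      (∀ k : ℕ, 2 ≤ k →
        HypPlane.IsModeSolution k (w k) ∧ w k 0 = 0 ∧
        (∀ v : ℝ → ℝ, HypPlane.IsModeSolution k v → v 0 = 0 → v = w k ∨ v = -w k) ∧
        (∀ v : ℝ → ℝ, HypPlane.IsModeSolution k v → ∃ θ₀ : ℝ, ∀ θ : ℝ, v θ = w k (θ + θ₀)) ∧
        ∃ u ∈ HypPlane.nonRadialPseudoRadialSolutions Ω (fun s => -s ^ 3),
          ∀ r θ : ℝ, 0 < r → HypPlane.polar r θ ∈ Ω →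
            u (HypPlane.polar r θ) = w k θ / Real.sinh r) ∧
      (∀ u : ℂ → ℝ,
        u ∈ HypPlane.nonRadialPseudoRadialSolutions Ω (fun s => -s ^ 3) ↔
          ∃ k : ℕ, 2 ≤ k ∧ ∃ θ₀ : ℝ, ∀ r θ : ℝ, 0 < r → HypPlane.polar r θ ∈ Ω →
            u (HypPlane.polar r θ) = w k (θ + θ₀) / Real.sinh r) := by
  refine ⟨?_, HypPlane.infinite_nonRadial hΩ, HypPlane.modeWave, fun k hk =>
    ⟨HypPlane.isModeSolution_modeWave hk, HypPlane.modeWave_zero k,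
      fun v hv h0 => hv.eq_or_eq_neg hk h0, fun v hv => ?_, ?_⟩, fun u =>
    ⟨HypPlane.exists_modeWave_of_mem hΩ, ?_⟩⟩
  · intro ε q hε _ hq hεq u hu hps
    by_contra hnr
    have hε0 : ε ≠ 0 := by rcases hε with rfl | rfl <;> norm_num
    obtain ⟨hq3, v, hv, hp, ⟨s, t, hst⟩, -⟩ :=
      HypPlane.pseudoRadial_structure hΩ hε0 hq hu hps hnr
    obtain rfl : ε = 1 := hεq.resolve_right (not_not.2 hq3)
    exact hst (hv.const_of_periodic hp s t)
  · obtain ⟨θ₀, rfl⟩ := hv.exists_eq_modeWave hk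
    exact ⟨θ₀, fun _ => rfl⟩
  · have hform : ∀ r θ : ℝ, 0 < r → HypPlane.angularProfile (HypPlane.modeWave k)
        (HypPlane.polar r θ) = HypPlane.modeWave k θ / Real.sinh r := fun r θ hr =>
      HypPlane.angularProfile_polar (HypPlane.periodic_modeWave hk) hr θ
    exact ⟨_, HypPlane.mem_nonRadial_of_modeWave hΩ hk (θ₀ := 0)
      fun r θ hr _ => by rw [hform r θ hr, add_zero], fun r θ hr _ => hform r θ hr⟩
  · rintro ⟨k, hk, θ₀, hu⟩
    exact HypPlane.mem_nonRadial_of_modeWave hΩ hk hu
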